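/- Let $\Omega\subset\mathbb R^2$ be a bounded, simply connected, polygonal domain. For $f\in L^2(\Omega)$ let $(\boldsymbol\sigma,u)=\mathcal L^{-1}f$ denote the unique pair $(\boldsymbol\sigma,u)\in \boldsymbol H(\mathrm{div};\Omega)\times L^2(\Omega)$ such that $$(\boldsymbol\sigma,\boldsymbol\tau)-(\mathrm{div}\,\boldsymbol\tau,u)=0\quad\forall\,\boldsymbol\tau\in\boldsymbol H(\mathrm{div};\Omega),\qquad (\mathrm{div}\,\boldsymbol\sigma,v)=(f,v)\quad\forall\,v\in L^2(\Omega),$$ where $(\cdot,\cdot)$ are the $L^2(\Omega)$ inner products (this is the mixed formulation of $-\Delta u=f$ in $\Omega$, $u=0$ on $\partial\Omega$, $\boldsymbol\sigma=-\nabla u$). Let $\mathcal T_H$ be a conforming triangulation of $\Omega$ whose shape regularity constant is at most $\kappa$, i.e. every triangle $T\in\mathcal T_H$ contains a disc of diameter $\rho>0$ with $H_T:=\mathrm{diam}(T)\le\kappa\rho$. Let $k\ge 0$ be an integer, let $U_H=\{v\in L^2(\Omega): v|_T \text{ is a polynomial of degree}\le k \text{ for all } T\in\mathcal T_H\}$ (so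 $k=p$ for the Raviart--Thomas element of order $p\ge0$ and $k=p-1$ for the Brezzi--Douglas--Marini element of order $p\ge1$), let $f_H\in U_H$ be the $L^2(\Omega)$-orthogonal projection of $f$ onto $U_H$, and let $$\mathrm{osc}(f,\mathcal T_H):=\Big(\sum_{T\in\mathcal T_H}H_T^2\,\|f-f_H\|_{L^2(T)}^2\Big)^{1/2}.$$ Then there is a constant $C_0>0$ depending only on $\kappa$ (not on $\Omega$, $\mathcal T_H$, $k$ or $f$) such that for every $f\in L^2(\Omega)$, with $(\boldsymbol\sigma,u)=\mathcal L^{-1}f$ and $(\tilde{\boldsymbol\sigma},\tilde u)=\mathcal L^{-1}f_H$, $$\|\boldsymbol\sigma-\tilde{\boldsymbol\sigma}\|_{L^2(\Omega)}\le\sqrt{C_0}\;\mathrm{osc}(f,\mathcal T_H).$$ -/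

import Mathlib

open MeasureTheory Set
open scoped ContDiff InnerProductSpace

/-- The Euclidean plane. -/
abbrev Plane : Type := EuclideanSpace ℝ (Fin 2)

namespace MixedPoisson

/-! ### Abstract well-posedness of the mixed problem -/

section Abstract

variable {E H₁ H₂ : Type*} [AddCommGroup E] [Module ℝ E]
  [NormedAddCommGroup H₁] [InnerProductSpace ℝ H₁] [CompleteSpace H₁]
  [NormedAddCommGroup H₂] [InnerProductSpace ℝ H₂] [CompleteSpace H₂]

/-- Abstract well-posedness: `G` plays the role of the gradient and `ι` the role of the inclusion
of test functions into `L²`. -/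
theorem abstract_exists (G : E →ₗ[ℝ] H₁) (ι : E →ₗ[ℝ] H₂) (C : ℝ)
    (hC : ∀ e, ‖ι e‖ ≤ C * ‖G e‖) (f : H₂) :
    ∃ (σ : H₁) (u : H₂), (∀ e, ⟪σ, G e⟫_ℝ = -⟪f, ι e⟫_ℝ) ∧
      ∀ (τ : H₁) (d : H₂), (∀ e, ⟪τ, G e⟫_ℝ = -⟪d, ι e⟫_ℝ) → ⟪σ, τ⟫_ℝ - ⟪d, u⟫_ℝ = 0 := by
  let P : E →ₗ[ℝ] WithLp 2 (H₁ × H₂) :=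
    (WithLp.linearEquiv 2 ℝ (H₁ × H₂)).symm.toLinearMap ∘ₗ G.prod ι
  let Γ : Submodule ℝ (WithLp 2 (H₁ × H₂)) := P.range.topologicalClosure
  have hP1 : ∀ e, (P e).fst = G e := fun e => rfl
  have hP2 : ∀ e, (P e).snd = ι e := fun e => rfl
  have hPΓ : ∀ e, P e ∈ Γ := fun e =>
    Submodule.le_topologicalClosure _ (LinearMap.mem_range_self P e)
  let p₁ : WithLp 2 (H₁ × H₂) →L[ℝ] H₁ := WithLp.fstL 2 ℝ H₁ H₂
  let p₂ : WithLp 2 (H₁ × H₂) →L[ℝ] H₂ := WithLp.sndL 2 ℝ H₁ H₂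
  have hcl : ∀ S : Set (WithLp 2 (H₁ × H₂)), IsClosed S → (∀ e, P e ∈ S) → ∀ x ∈ Γ, x ∈ S := by
    intro S hS h x hx
    have : closure (P.range : Set (WithLp 2 (H₁ × H₂))) ⊆ S := by
      apply closure_minimal _ hS
      rintro _ ⟨e, rfl⟩
      exact h e
    exact this hx
  have hΓ1 : ∀ x ∈ Γ, ‖p₂ x‖ ≤ C * ‖p₁ x‖ := by
    apply hcl {x | ‖p₂ x‖ ≤ C * ‖p₁ x‖}
    · exact isClosed_le (by fun_prop) (by fun_prop)
    · exact fun e => hC e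
  have hΓ2 : ∀ (τ : H₁) (d : H₂), (∀ e, ⟪τ, G e⟫_ℝ = -⟪d, ι e⟫_ℝ) →
      ∀ x ∈ Γ, ⟪τ, p₁ x⟫_ℝ = -⟪d, p₂ x⟫_ℝ := by
    intro τ d h
    apply hcl {x | ⟪τ, p₁ x⟫_ℝ = -⟪d, p₂ x⟫_ℝ}
    · exact isClosed_eq (by fun_prop) (by fun_prop)
    · exact h
  have : CompleteSpace Γ := P.range.isClosed_topologicalClosure.completeSpace_coe
  let q : Γ →L[ℝ] H₁ := p₁ ∘L Γ.subtypeL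
  let B : Γ →L[ℝ] Γ →L[ℝ] ℝ := (innerSL ℝ).bilinearComp q q
  have hB : ∀ x y : Γ, B x y = ⟪p₁ x, p₁ y⟫_ℝ := fun x y => rfl
  have hco : IsCoercive B := by
    refine ⟨(1 + C ^ 2)⁻¹, by positivity, fun x => ?_⟩
    rw [hB, real_inner_self_eq_norm_sq, inv_mul_eq_div, div_mul_eq_mul_div,
      div_le_iff₀ (by positivity)]
    have h1 : ‖(x : WithLp 2 (H₁ × H₂))‖ ^ 2 = ‖p₁ x‖ ^ 2 + ‖p₂ x‖ ^ 2 :=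
      WithLp.prod_norm_sq_eq_of_L2 _
    have h2 := hΓ1 x x.2
    have h3 : ‖p₂ x‖ ^ 2 ≤ (C * ‖p₁ x‖) ^ 2 := pow_le_pow_left₀ (norm_nonneg _) h2 2
    rw [← Submodule.coe_norm] at h1
    nlinarith
  let ℓ : Γ →L[ℝ] ℝ := (innerSL ℝ f) ∘L p₂ ∘L Γ.subtypeL
  let w : Γ := (InnerProductSpace.toDual ℝ Γ).symm ℓ
  let z : Γ := hco.continuousLinearEquivOfBilin.symm w
  have hz : ∀ y : Γ, ⟪p₁ z, p₁ y⟫_ℝ = ⟪f, p₂ y⟫_ℝ := by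
    intro y
    rw [← hB, ← hco.continuousLinearEquivOfBilin_apply]
    simp only [z, ContinuousLinearEquiv.apply_symm_apply, w,
      InnerProductSpace.toDual_symm_apply]
    rfl
  refine ⟨-p₁ z, p₂ z, fun e => ?_, fun τ d h => ?_⟩
  · rw [inner_neg_left]
    exact congrArg Neg.neg (hz ⟨P e, hPΓ e⟩)
  · have := hΓ2 τ d h z z.2
    rw [inner_neg_left, real_inner_comm]
    linarith

theorem abstract_existsUnique (G : E →ₗ[ℝ] H₁) (ι : E →ₗ[ℝ] H₂) (C : ℝ)
    (hC : ∀ e, ‖ι e‖ ≤ C * ‖G e‖) (f : H₂) :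
    ∃! s : H₁ × H₂,
      (∀ (τ : H₁) (d : H₂), (∀ e, ⟪τ, G e⟫_ℝ = -⟪d, ι e⟫_ℝ) → ⟪s.1, τ⟫_ℝ - ⟪d, s.2⟫_ℝ = 0) ∧
      ∃ d : H₂, (∀ e, ⟪s.1, G e⟫_ℝ = -⟪d, ι e⟫_ℝ) ∧ ∀ v, ⟪d, v⟫_ℝ = ⟪f, v⟫_ℝ := by
  obtain ⟨σ, u, h1, h2⟩ := abstract_exists G ι C hC f
  refine ⟨(σ, u), ⟨h2, f, h1, fun _ => rfl⟩, ?_⟩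
  rintro ⟨σ', u'⟩ ⟨h2', d, h1', hd⟩
  simp only at h2' h1'
  have hdf : d = f := ext_inner_right ℝ hd
  subst hdf
  have hσ : σ' = σ := by
    have hz : ∀ e, ⟪σ' - σ, G e⟫_ℝ = -⟪(0 : H₂), ι e⟫_ℝ := by
      intro e
      rw [inner_sub_left, h1, h1']
      simp
    have a := h2 _ _ hz
    have b := h2' _ _ hz
    rw [inner_zero_left, sub_zero] at a b
    have : ⟪σ' - σ, σ' - σ⟫_ℝ = 0 := by
      rw [inner_sub_left, a, b, sub_zero]
    exact sub_eq_zero.mp (inner_self_eq_zero.mp this)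
  subst hσ
  have hu : u' = u := by
    obtain ⟨τ, -, ht, -⟩ := abstract_exists G ι C hC (u' - u)
    have a := h2 _ _ ht
    have b := h2' _ _ ht
    have : ⟪u' - u, u' - u⟫_ℝ = 0 := by
      rw [inner_sub_right]; linarith
    exact sub_eq_zero.mp (inner_self_eq_zero.mp this)
  rw [hu]

end Abstract

/-! ### Function spaces -/

/-- The space `L²(Ω)`. -/
abbrev L2 (Ω : Set Plane) : Type := Lp ℝ 2 (volume.restrict Ω)

/-- The space `L²(Ω)²` of square integrable vector fields. -/
abbrev L2Vec (Ω : Set Plane) : Type := Lp Plane 2 (volume.restrict Ω)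

/-- The space `C_c^∞(Ω)` of test functions. -/
def testFunctions (Ω : Set Plane) : Submodule ℝ (Plane → ℝ) where
  carrier := {φ | ContDiff ℝ ∞ φ ∧ HasCompactSupport φ ∧ tsupport φ ⊆ Ω}
  zero_mem' := by
    refine ⟨contDiff_const, HasCompactSupport.zero, ?_⟩
    simp [tsupport]
  add_mem' := by
    rintro φ ψ ⟨h1, h2, h3⟩ ⟨k1, k2, k3⟩
    exact ⟨h1.add k1, h2.add k2, (tsupport_add φ ψ).trans (union_subset h3 k3)⟩
  smul_mem' := by
    rintro c φ ⟨h1, h2, h3⟩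
    refine ⟨h1.const_smul c, h2.smul_left (f := fun _ => c), ?_⟩
    exact (tsupport_smul_subset_right (fun _ => c) φ).trans h3

/-- `d ∈ L²(Ω)` is the weak divergence of the vector field `τ ∈ L²(Ω)²`:
`∫_Ω τ · ∇φ = - ∫_Ω d φ` for every test function `φ ∈ C_c^∞(Ω)`. -/
def HasWeakDiv (Ω : Set Plane) (τ : L2Vec Ω) (d : L2 Ω) : Prop :=
  ∀ φ ∈ testFunctions Ω, ∫ x in Ω, ⟪τ x, gradient φ x⟫_ℝ = -∫ x in Ω, d x * φ x

/-- `s = (σ, u)` solves the mixed variational formulation of the Poisson problem with datum `f`: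
`σ, τ` range over `H(div; Ω)` (the fields in `L²(Ω)²` that have a weak divergence in `L²(Ω)`),
`u, v` range over `L²(Ω)`, and
`(σ, τ) - (div τ, u) = 0` for all `τ`, `(div σ, v) = (f, v)` for all `v`. -/
def IsMixedSolution (Ω : Set Plane) (f : L2 Ω) (s : L2Vec Ω × L2 Ω) : Prop :=
  (∀ (τ : L2Vec Ω) (divτ : L2 Ω), HasWeakDiv Ω τ divτ → ⟪s.1, τ⟫_ℝ - ⟪divτ, s.2⟫_ℝ = 0) ∧
  ∃ divσ : L2 Ω, HasWeakDiv Ω s.1 divσ ∧ ∀ v : L2 Ω, ⟪divσ, v⟫_ℝ = ⟪f, v⟫_ℝ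

/-! ### Well-posedness of the mixed problem on a bounded set -/

theorem gradient_eq_comp (φ : Plane → ℝ) :
    gradient φ = (InnerProductSpace.toDual ℝ Plane).symm ∘ fderiv ℝ φ := rfl

theorem testFunctions.memLp {Ω : Set Plane} {φ : Plane → ℝ} (hφ : φ ∈ testFunctions Ω) :
    MemLp φ 2 (volume.restrict Ω) :=
  (hφ.1.continuous.memLp_of_hasCompactSupport hφ.2.1).restrict Ω

theorem testFunctions.memLp_gradient {Ω : Set Plane} {φ : Plane → ℝ}
    (hφ : φ ∈ testFunctions Ω) : MemLp (gradient φ) 2 (volume.restrict Ω) := by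
  refine MemLp.restrict Ω (Continuous.memLp_of_hasCompactSupport ?_ ?_)
  · rw [gradient_eq_comp]
    exact (LinearIsometryEquiv.continuous _).comp (hφ.1.continuous_fderiv (by simp))
  · rw [gradient_eq_comp]
    exact (hφ.2.1.fderiv ℝ).comp_left (by simp)

/-- The inclusion of test functions into `L²(Ω)`. -/
noncomputable def testToL2 (Ω : Set Plane) : testFunctions Ω →ₗ[ℝ] L2 Ω where
  toFun φ := (testFunctions.memLp φ.2).toLp φ
  map_add' _ _ := rfl
  map_smul' _ _ := rfl

theorem gradient_add_of_test {Ω : Set Plane} (φ ψ : testFunctions Ω) :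
    gradient ((φ + ψ : testFunctions Ω) : Plane → ℝ) =
      gradient (φ : Plane → ℝ) + gradient (ψ : Plane → ℝ) := by
  ext1 x
  have h1 := (φ.2.1.differentiable (by simp)) x
  have h2 := (ψ.2.1.differentiable (by simp)) x
  simp only [gradient, Submodule.coe_add, Pi.add_apply]
  rw [fderiv_add h1 h2, map_add]

theorem gradient_smul_of_test {Ω : Set Plane} (c : ℝ) (φ : testFunctions Ω) :
    gradient ((c • φ : testFunctions Ω) : Plane → ℝ) = c • gradient (φ : Plane → ℝ) := by
  ext1 x
  have h1 := (φ.2.1.differentiable (by simp)) x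
  simp only [gradient, Submodule.coe_smul, Pi.smul_apply]
  rw [fderiv_const_smul h1]
  simp

theorem toLp_eq_add {μ : Measure Plane} {F G H : Plane → Plane} (hF : MemLp F 2 μ)
    (hG : MemLp G 2 μ) (hH : MemLp H 2 μ) (h : H = F + G) :
    hH.toLp H = hF.toLp F + hG.toLp G := by
  subst h
  rfl

theorem toLp_eq_smul {μ : Measure Plane} {F H : Plane → Plane} (c : ℝ) (hF : MemLp F 2 μ)
    (hH : MemLp H 2 μ) (h : H = c • F) : hH.toLp H = c • hF.toLp F := by
  subst h
  rfl

/-- The gradient of test functions as a map into `L²(Ω)²`. -/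
noncomputable def gradToL2 (Ω : Set Plane) : testFunctions Ω →ₗ[ℝ] L2Vec Ω where
  toFun φ := (testFunctions.memLp_gradient φ.2).toLp (gradient (φ : Plane → ℝ))
  map_add' φ ψ := toLp_eq_add _ _ _ (gradient_add_of_test φ ψ)
  map_smul' c φ := toLp_eq_smul c _ _ (gradient_smul_of_test c φ)

theorem hasWeakDiv_iff {Ω : Set Plane} (τ : L2Vec Ω) (d : L2 Ω) :
    HasWeakDiv Ω τ d ↔
      ∀ φ : testFunctions Ω, ⟪τ, gradToL2 Ω φ⟫_ℝ = -⟪d, testToL2 Ω φ⟫_ℝ := by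
  have h1 : ∀ φ : testFunctions Ω,
      ⟪τ, gradToL2 Ω φ⟫_ℝ = ∫ x in Ω, ⟪τ x, gradient (φ : Plane → ℝ) x⟫_ℝ := by
    intro φ
    rw [L2.inner_def]
    refine integral_congr_ae ?_
    filter_upwards [(testFunctions.memLp_gradient φ.2).coeFn_toLp] with x hx
    exact congrArg (fun y => ⟪τ x, y⟫_ℝ) hx
  have h2 : ∀ φ : testFunctions Ω,
      ⟪d, testToL2 Ω φ⟫_ℝ = ∫ x in Ω, d x * (φ : Plane → ℝ) x := by
    intro φ
    rw [L2.inner_def]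
    refine integral_congr_ae ?_
    filter_upwards [(testFunctions.memLp φ.2).coeFn_toLp] with x hx
    refine (congrArg (fun y => ⟪d x, y⟫_ℝ) hx).trans ?_
    simp [mul_comm]
  constructor
  · intro h φ
    rw [h1, h2]
    exact h φ φ.2
  · intro h φ hφ
    have := h ⟨φ, hφ⟩
    rwa [h1, h2] at this

/-- Poincaré's inequality for test functions on a bounded set. -/
theorem poincare_test {Ω : Set Plane} (hΩ : Bornology.IsBounded Ω) :
    ∃ C : ℝ, ∀ φ : testFunctions Ω, ‖testToL2 Ω φ‖ ≤ C * ‖gradToL2 Ω φ‖ := by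
  let c : NNReal := eLpNormLESNormFDerivOfLeConst ℝ (volume : Measure Plane) Ω 1 2
  let m : ENNReal := (volume.restrict Ω) univ ^ (1 / (1 : ENNReal).toReal - 1 / (2 : ENNReal).toReal)
  have hm : m ≠ ⊤ := by
    refine ENNReal.rpow_ne_top_of_nonneg (by norm_num) ?_
    rw [Measure.restrict_apply_univ]
    exact hΩ.measure_lt_top.ne
  refine ⟨(c * m).toReal, fun φ => ?_⟩
  obtain ⟨h1, h2, h3⟩ := φ.2
  have hsupp : Function.support (φ : Plane → ℝ) ⊆ Ω := (subset_tsupport _).trans h3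
  have hsupp' : Function.support (fderiv ℝ (φ : Plane → ℝ)) ⊆ Ω :=
    (support_fderiv_subset ℝ).trans h3
  have key := eLpNorm_le_eLpNorm_fderiv_of_le (volume : Measure Plane) (p := 1) (q := 2)
    (h1.of_le (by simp)) hsupp le_rfl (by simp) (by norm_num) hΩ
  have hr : eLpNorm (fderiv ℝ (φ : Plane → ℝ)) 1 volume
      = eLpNorm (gradient (φ : Plane → ℝ)) 1 (volume.restrict Ω) := by
    rw [← eLpNorm_restrict_eq_of_support_subset (f := fderiv ℝ (φ : Plane → ℝ)) hsupp']
    refine eLpNorm_congr_norm_ae (Filter.Eventually.of_forall fun x => ?_)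
    simp [gradient]
  have hh : eLpNorm (gradient (φ : Plane → ℝ)) 1 (volume.restrict Ω)
      ≤ eLpNorm (gradient (φ : Plane → ℝ)) 2 (volume.restrict Ω) * m :=
    eLpNorm_le_eLpNorm_mul_rpow_measure_univ (by norm_num)
      (testFunctions.memLp_gradient φ.2).1
  have tot : eLpNorm (φ : Plane → ℝ) 2 (volume.restrict Ω)
      ≤ (c * m) * eLpNorm (gradient (φ : Plane → ℝ)) 2 (volume.restrict Ω) := by
    calc _ ≤ eLpNorm (φ : Plane → ℝ) 2 volume := eLpNorm_restrict_le _ _ _ _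
      _ ≤ c * eLpNorm (fderiv ℝ (φ : Plane → ℝ)) 1 volume := by simpa using key
      _ ≤ c * (eLpNorm (gradient (φ : Plane → ℝ)) 2 (volume.restrict Ω) * m) := by
        rw [hr]; gcongr
      _ = _ := by ring
  have e1 : ‖testToL2 Ω φ‖ = (eLpNorm (φ : Plane → ℝ) 2 (volume.restrict Ω)).toReal :=
    Lp.norm_toLp _ (testFunctions.memLp φ.2)
  have e2 : ‖gradToL2 Ω φ‖
      = (eLpNorm (gradient (φ : Plane → ℝ)) 2 (volume.restrict Ω)).toReal :=
    Lp.norm_toLp _ (testFunctions.memLp_gradient φ.2)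
  rw [e1, e2, ← ENNReal.toReal_mul]
  refine ENNReal.toReal_mono ?_ tot
  exact ENNReal.mul_ne_top (ENNReal.mul_ne_top (by simp) hm)
    (testFunctions.memLp_gradient φ.2).2.ne

/-- The mixed problem has exactly one solution. -/
theorem existsUnique_isMixedSolution {Ω : Set Plane} (hΩ : Bornology.IsBounded Ω) (f : L2 Ω) :
    ∃! s : L2Vec Ω × L2 Ω, IsMixedSolution Ω f s := by
  obtain ⟨C, hC⟩ := poincare_test hΩ
  have := abstract_existsUnique (gradToL2 Ω) (testToL2 Ω) C hC f
  simpa only [IsMixedSolution, hasWeakDiv_iff] using this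

/-! ### Polygonal domains, triangulations, piecewise polynomials -/

/-- A bounded, simply connected (hence connected and non-empty), polygonal domain of the plane:
the boundary is a finite union of line segments. -/
structure IsPolygonalDomain (Ω : Set Plane) : Prop where
  isOpen : IsOpen Ω
  isBounded : Bornology.IsBounded Ω
  isSimplyConnected : IsSimplyConnected Ω
  frontier_eq : ∃ S : Finset (Plane × Plane), frontier Ω = ⋃ e ∈ S, segment ℝ e.1 e.2

/-- The solution operator `f ↦ (σ, u) = 𝓛⁻¹ f` of the mixed formulation of
`-Δu = f` in `Ω`, `u = 0` on `∂Ω`, `σ = -∇u`. -/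
noncomputable def solutionOp {Ω : Set Plane} (hΩ : IsPolygonalDomain Ω) (f : L2 Ω) :
    L2Vec Ω × L2 Ω :=
  (existsUnique_isMixedSolution hΩ.isBounded f).choose

theorem solutionOp_spec {Ω : Set Plane} (hΩ : IsPolygonalDomain Ω) (f : L2 Ω) :
    IsMixedSolution Ω f (solutionOp hΩ f) :=
  (existsUnique_isMixedSolution hΩ.isBounded f).choose_spec.1

/-- A conforming triangulation of `Ω`: finitely many non-degenerate closed triangles, given by
their vertex sets, with interiors in `Ω` and with union `closure Ω`, such that two triangles
meet exactly in the convex hull of their common vertices (so distinct triangles share nothing,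
a vertex, or a whole edge). -/
structure Triangulation (Ω : Set Plane) where
  triangles : Finset (Finset Plane)
  card_eq_three : ∀ t ∈ triangles, t.card = 3
  affineIndependent : ∀ t ∈ triangles, AffineIndependent ℝ (fun v : t => (v : Plane))
  interior_subset : ∀ t ∈ triangles, interior (convexHull ℝ (t : Set Plane)) ⊆ Ω
  iUnion_eq : ⋃ t ∈ triangles, convexHull ℝ (t : Set Plane) = closure Ω
  conforming : ∀ t₁ ∈ triangles, ∀ t₂ ∈ triangles,
    convexHull ℝ (t₁ : Set Plane) ∩ convexHull ℝ (t₂ : Set Plane)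
      = convexHull ℝ ((t₁ : Set Plane) ∩ (t₂ : Set Plane))

/-- The triangulation has shape regularity constant at most `κ`: every triangle `T` contains a
disc whose diameter `2r` satisfies `diam T ≤ κ · 2r`. -/
def Triangulation.ShapeRegular {Ω : Set Plane} (𝒯 : Triangulation Ω) (κ : ℝ) : Prop :=
  ∀ t ∈ 𝒯.triangles, ∃ (x : Plane) (r : ℝ), 0 < r ∧
    Metric.closedBall x r ⊆ convexHull ℝ (t : Set Plane) ∧
    Metric.diam (convexHull ℝ (t : Set Plane)) ≤ κ * (2 * r)

/-- The space of `v ∈ L²(Ω)` whose restriction to every triangle is (a.e.) a polynomial of total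
degree at most `k`. This is the scalar space of the Raviart-Thomas element of order `p` for
`k = p`, and of the Brezzi-Douglas-Marini element of order `p ≥ 1` for `k = p - 1`. -/
def Triangulation.piecewisePoly {Ω : Set Plane} (𝒯 : Triangulation Ω) (k : ℕ) :
    Submodule ℝ (L2 Ω) where
  carrier := {v | ∀ t ∈ 𝒯.triangles, ∃ q : MvPolynomial (Fin 2) ℝ, q.totalDegree ≤ k ∧
    ∀ᵐ x ∂((volume.restrict Ω).restrict (convexHull ℝ (t : Set Plane))),
      v x = MvPolynomial.eval (fun i => x i) q}
  zero_mem' := by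
    intro t _
    refine ⟨0, by simp, ?_⟩
    filter_upwards [ae_restrict_of_ae (Lp.coeFn_zero ℝ 2 (volume.restrict Ω))] with x hx
    rw [hx]
    simp
  add_mem' := by
    intro v w hv hw t ht
    obtain ⟨q, hq, h1⟩ := hv t ht
    obtain ⟨r, hr, h2⟩ := hw t ht
    refine ⟨q + r, (MvPolynomial.totalDegree_add q r).trans (max_le hq hr), ?_⟩
    filter_upwards [ae_restrict_of_ae (Lp.coeFn_add v w), h1, h2] with x hx h1 h2
    rw [hx, map_add, Pi.add_apply, h1, h2]
  smul_mem' := by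
    intro c v hv t ht
    obtain ⟨q, hq, h1⟩ := hv t ht
    refine ⟨c • q, (MvPolynomial.totalDegree_smul_le c q).trans hq, ?_⟩
    filter_upwards [ae_restrict_of_ae (Lp.coeFn_smul c v), h1] with x hx h1
    rw [hx, Pi.smul_apply, h1, MvPolynomial.smul_eval, smul_eq_mul]

/-- Square integrable polynomials of degree at most `k` form a finite dimensional, hence closed,
subspace of `L²`. -/
theorem isClosed_poly (μ : Measure Plane) (k : ℕ) :
    IsClosed {w : Lp ℝ 2 μ | ∃ q : MvPolynomial (Fin 2) ℝ, q.totalDegree ≤ k ∧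
      ∀ᵐ x ∂μ, w x = MvPolynomial.eval (fun i => x i) q} := by
  let S : Submodule ℝ (MvPolynomial.restrictTotalDegree (Fin 2) ℝ k) :=
    { carrier := {q | MemLp (fun x : Plane => MvPolynomial.eval (fun i => x i) q.1) 2 μ}
      zero_mem' := by simp
      add_mem' := by
        intro q r hq hr
        simpa [Pi.add_def] using MemLp.add hq hr
      smul_mem' := by
        intro c q hq
        simpa [Pi.smul_def] using MemLp.const_smul hq c }
  let Φ : S →ₗ[ℝ] Lp ℝ 2 μ :=
    { toFun := fun q => MemLp.toLp _ q.2
      map_add' := by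
        intro q r
        rw [← MemLp.toLp_add]
        exact MemLp.toLp_congr _ _ (by simp [Pi.add_def])
      map_smul' := by
        intro c q
        rw [RingHom.id_apply, ← MemLp.toLp_const_smul]
        exact MemLp.toLp_congr _ _ (by simp [Pi.smul_def]) }
  have : {w : Lp ℝ 2 μ | ∃ q : MvPolynomial (Fin 2) ℝ, q.totalDegree ≤ k ∧
      ∀ᵐ x ∂μ, w x = MvPolynomial.eval (fun i => x i) q} = (Φ.range : Set (Lp ℝ 2 μ)) := by
    ext w
    constructor
    · rintro ⟨q, hq, h⟩
      have hm : MemLp (fun x : Plane => MvPolynomial.eval (fun i => x i) q) 2 μ :=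
        (memLp_congr_ae h).mp (Lp.memLp w)
      refine ⟨⟨⟨q, (MvPolynomial.mem_restrictTotalDegree _ _ _).mpr hq⟩, hm⟩, ?_⟩
      refine Lp.ext ?_
      filter_upwards [hm.coeFn_toLp, h] with x h1 h2
      exact h1.trans h2.symm
    · rintro ⟨q, rfl⟩
      refine ⟨q.1.1, (MvPolynomial.mem_restrictTotalDegree _ _ _).mp q.1.2, ?_⟩
      exact MemLp.coeFn_toLp q.2
  rw [this]
  exact Submodule.closed_of_finiteDimensional _

instance {Ω : Set Plane} (𝒯 : Triangulation Ω) (k : ℕ) : CompleteSpace (𝒯.piecewisePoly k) := by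
  refine IsClosed.completeSpace_coe (hs := ?_)
  have : (𝒯.piecewisePoly k : Set (L2 Ω)) = ⋂ t ∈ 𝒯.triangles,
      (LpToLpRestrictCLM Plane ℝ ℝ (volume.restrict Ω) 2 (convexHull ℝ (t : Set Plane))) ⁻¹'
        {w | ∃ q : MvPolynomial (Fin 2) ℝ, q.totalDegree ≤ k ∧
          ∀ᵐ x ∂((volume.restrict Ω).restrict (convexHull ℝ (t : Set Plane))),
            w x = MvPolynomial.eval (fun i => x i) q} := by
    ext v
    simp only [mem_iInter, mem_preimage, mem_ofPred_eq]
    refine forall₂_congr fun t _ => exists_congr fun q => and_congr_right fun _ => ?_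
    refine Filter.eventually_congr ?_
    filter_upwards [LpToLpRestrictCLM_coeFn (μ := volume.restrict Ω) (p := 2) ℝ
      (convexHull ℝ (t : Set Plane)) v] with x hx
    rw [hx]
  rw [this]
  exact isClosed_biInter fun t _ => (isClosed_poly _ k).preimage (ContinuousLinearMap.continuous _)

/-- `f_H`: the `L²(Ω)`-orthogonal projection of `f` onto the piecewise polynomials. -/
noncomputable def Triangulation.proj {Ω : Set Plane} (𝒯 : Triangulation Ω) (k : ℕ) (f : L2 Ω) :
    L2 Ω :=
  (𝒯.piecewisePoly k).starProjection f

/-- The data oscillation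
`osc(f, 𝒯) = (∑_{T ∈ 𝒯} diam(T)² ‖f - f_H‖²_{L²(T)})^{1/2}`. -/
noncomputable def Triangulation.osc {Ω : Set Plane} (𝒯 : Triangulation Ω) (k : ℕ) (f : L2 Ω) : ℝ :=
  Real.sqrt (∑ t ∈ 𝒯.triangles, Metric.diam (convexHull ℝ (t : Set Plane)) ^ 2 *
    ∫ x in convexHull ℝ (t : Set Plane), (f x - 𝒯.proj k f x) ^ 2 ∂(volume.restrict Ω))

end MixedPoisson

/-!
The difference `τ = σ - σ̃` of the two fluxes is the flux for the datum `g = f - f_H`. Testing the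
first mixed equation with divergence-free fields shows that `τ` is orthogonal to everything that
is orthogonal to the gradients of test functions, so `τ` lies in the closure of those gradients.
Since `(τ, ∇φ) = -(g, φ)` for test functions `φ`, the norm of `τ` is at most the best constant `M`
in `|(g, φ)| ≤ M ‖∇φ‖` (`norm_le_of_abs_inner_range_le`). That constant is at most
`2 osc(f, 𝒯_H)` (`abs_inner_sub_proj_testToL2_le`), which gives the theorem with `C₀ = 4`:

* the triangles partition `Ω` up to null sets (`Triangulation.integral_eq_sum_triangles`), and
  the indicator of a triangle is a piecewise polynomial, so `g` has mean value zero on each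
  triangle (`Triangulation.integral_sub_proj_eq_zero`) and `(g, φ)_T = (g, φ - c)_T` for all
  constants `c`;
* for a suitable `c`, Poincaré's inequality `‖φ - c‖_T ≤ 2 diam(T) ‖∇φ‖_T` holds
  (`exists_integral_sub_sq_le`), and the Cauchy-Schwarz inequality for the sum over the triangles
  concludes.

The factor `2` in Poincaré's inequality is the same for all convex sets. Writing
`φ y - φ x` as an integral of `∇φ` over the segment from `x` to `y`, one has to bound the average
over `x, y ∈ T` of `|∇φ|²` at `(1 - t) x + t y`. For `t ≤ 1/2` the change of variables in `x`, and
for `t ≥ 1/2` that in `y`, has Jacobian at least `1/4`, and the image stays in `T` by convexity.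
-/

namespace MixedPoisson

/-! ### The Poincaré inequality on convex sets -/

/-- Cauchy-Schwarz for the integral of a product of real square integrable functions. -/
theorem abs_integral_mul_le_sqrt {α : Type*} [MeasurableSpace α] {μ : Measure α} {f g : α → ℝ}
    (hf : MemLp f 2 μ) (hg : MemLp g 2 μ) :
    |∫ x, f x * g x ∂μ| ≤ √(∫ x, f x ^ 2 ∂μ) * √(∫ x, g x ^ 2 ∂μ) := by
  have inner_eq : ∀ {u v : α → ℝ} (hu : MemLp u 2 μ) (hv : MemLp v 2 μ),
      ⟪hu.toLp u, hv.toLp v⟫_ℝ = ∫ x, u x * v x ∂μ := by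
    intro u v hu hv
    rw [L2.inner_def]
    refine integral_congr_ae ?_
    filter_upwards [hu.coeFn_toLp, hv.coeFn_toLp] with x h1 h2
    simp [h1, h2, mul_comm]
  have norm_eq : ∀ {u : α → ℝ} (hu : MemLp u 2 μ), ‖hu.toLp u‖ = √(∫ x, u x ^ 2 ∂μ) := by
    intro u hu
    simp only [norm_eq_sqrt_real_inner, inner_eq, sq]
  rw [← inner_eq hf hg, ← norm_eq hf, ← norm_eq hg]
  exact abs_real_inner_le_norm _ _

/-- The fundamental theorem of calculus along the segment from `x` to `y`, followed by
Cauchy-Schwarz on `[0, 1]`. -/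
theorem sq_sub_le_integral_segment {φ : Plane → ℝ} (hφ : ContDiff ℝ 1 φ) (x y : Plane) :
    (φ y - φ x) ^ 2 ≤
      ‖y - x‖ ^ 2 * ∫ t in Icc (0 : ℝ) 1, ‖fderiv ℝ φ ((1 - t) • x + t • y)‖ ^ 2 := by
  have hc : Continuous fun t : ℝ => fderiv ℝ φ ((1 - t) • x + t • y) :=
    (hφ.continuous_fderiv one_ne_zero).comp (by fun_prop)
  have hd : ∀ t : ℝ, HasDerivAt (fun t : ℝ => φ ((1 - t) • x + t • y))
      (fderiv ℝ φ ((1 - t) • x + t • y) (y - x)) t := by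
    intro t
    have h1 : HasDerivAt (fun t : ℝ => (1 - t) • x + t • y) (y - x) t := by
      have := (((hasDerivAt_id t).const_sub 1).smul_const x).add ((hasDerivAt_id t).smul_const y)
      rw [neg_one_smul, one_smul, neg_add_eq_sub] at this
      exact this
    exact ((hφ.differentiable one_ne_zero) _).hasFDerivAt.comp_hasDerivAt t h1
  have hc' : Continuous fun t : ℝ => fderiv ℝ φ ((1 - t) • x + t • y) (y - x) :=
    hc.clm_apply continuous_const
  have ftc := intervalIntegral.integral_eq_sub_of_hasDerivAt (a := 0) (b := 1)
    (fun t _ => hd t) (hc'.intervalIntegrable 0 1)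
  rw [intervalIntegral.integral_of_le zero_le_one, ← integral_Icc_eq_integral_Ioc] at ftc
  simp only [sub_self, zero_smul, one_smul, zero_add, sub_zero, add_zero] at ftc
  have hm : MemLp (fun t : ℝ => fderiv ℝ φ ((1 - t) • x + t • y) (y - x)) 2
      (volume.restrict (Icc (0 : ℝ) 1)) :=
    (memLp_two_iff_integrable_sq hc'.aestronglyMeasurable).2
      ((hc'.pow 2).continuousOn.integrableOn_compact isCompact_Icc)
  have cs := abs_integral_mul_le_sqrt hm (memLp_const (1 : ℝ))
  simp only [mul_one, ftc, one_pow, integral_const, smul_eq_mul, measureReal_restrict_apply_univ,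
    Real.volume_real_Icc_of_le zero_le_one, sub_zero, Real.sqrt_one] at cs
  rw [← sq_abs, ← Real.le_sqrt (abs_nonneg _) (by positivity)]
  refine cs.trans (Real.sqrt_le_sqrt ?_)
  rw [← integral_const_mul]
  refine integral_mono hm.integrable_sq ?_ fun t => ?_
  · exact ((hc.norm.pow 2).const_mul _).continuousOn.integrableOn_compact isCompact_Icc
  · have := (fderiv ℝ φ ((1 - t) • x + t • y)).le_opNorm (y - x)
    calc _ = ‖fderiv ℝ φ ((1 - t) • x + t • y) (y - x)‖ ^ 2 := by simp
      _ ≤ (‖fderiv ℝ φ ((1 - t) • x + t • y)‖ * ‖y - x‖) ^ 2 := by gcongr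
      _ = _ := by ring

/-- The contraction `x ↦ s x + (1 - s) y` towards a point of a convex set maps the set into
itself, and for `1/2 ≤ s` its Jacobian `s²` is at least `1/4`. -/
theorem setLIntegral_comp_contraction_le {K : Set Plane} (hK : Convex ℝ K) (hKm : MeasurableSet K)
    {H : Plane → ENNReal} (hH : Measurable H) {s : ℝ} (hs : 1 / 2 ≤ s) (hs1 : s ≤ 1)
    {y : Plane} (hy : y ∈ K) :
    ∫⁻ x in K, H (s • x + (1 - s) • y) ≤ 4 * ∫⁻ x in K, H x := by
  have hs0 : 0 < s := by linarith
  rw [← lintegral_indicator hKm, ← lintegral_indicator hKm]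
  have hg : Measurable (K.indicator H) := hH.indicator hKm
  calc ∫⁻ x, K.indicator (fun x => H (s • x + (1 - s) • y)) x
      ≤ ∫⁻ x, K.indicator H (s • x + (1 - s) • y) := by
        refine lintegral_mono fun x => ?_
        by_cases hx : x ∈ K
        · have : s • x + (1 - s) • y ∈ K :=
            hK hx hy hs0.le (by linarith) (by ring)
          simp [hx, this]
        · simp [hx]
    _ = ∫⁻ z, K.indicator H (z + (1 - s) • y) ∂(Measure.map (s • ·) volume) := by
        rw [lintegral_map (by fun_prop) (by fun_prop)]
    _ = ENNReal.ofReal (|(s ^ 2)⁻¹|) * ∫⁻ z, K.indicator H z := by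
        rw [Measure.map_addHaar_smul _ hs0.ne', lintegral_smul_measure,
          lintegral_add_right_eq_self (fun z => K.indicator H z)]
        simp
    _ ≤ 4 * ∫⁻ x, K.indicator H x := by
        gcongr
        rw [← ENNReal.ofReal_ofNat]
        refine ENNReal.ofReal_le_ofReal ?_
        rw [abs_of_pos (by positivity), inv_le_comm₀ (by positivity) (by norm_num)]
        norm_num
        nlinarith

/-- Bound for the integral over `x, y ∈ K` of `H` at the point of parameter `t` on the segment from
`x` to `y`. One contracts towards `y` if `t ≤ 1/2` and towards `x` otherwise, which keeps the
Jacobian away from `0`. -/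
theorem lintegral_lintegral_segment_le {K : Set Plane} (hK : Convex ℝ K) (hKm : MeasurableSet K)
    {H : Plane → ENNReal} (hH : Measurable H) {t : ℝ} (ht : t ∈ Icc (0 : ℝ) 1) :
    ∫⁻ y in K, ∫⁻ x in K, H ((1 - t) • x + t • y) ≤ 4 * (∫⁻ x in K, H x) * volume K := by
  wlog h : t ≤ 1 / 2 generalizing t
  · have := this (t := 1 - t) ⟨by linarith [ht.2], by linarith [ht.1]⟩ (by linarith)
    rw [lintegral_lintegral_swap (Measurable.aemeasurable (by fun_prop))] at this
    simpa [add_comm] using this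
  · rw [← setLIntegral_const]
    refine setLIntegral_mono measurable_const fun y hy => ?_
    simpa using setLIntegral_comp_contraction_le hK hKm hH (s := 1 - t) (by linarith)
      (by linarith [ht.1]) hy

/-- Poincaré's inequality on a compact convex set, with a constant that depends on the diameter
only. The subtracted constant is a value of `φ` chosen by the first moment method. -/
theorem exists_integral_sub_sq_le {K : Set Plane} (hK : Convex ℝ K) (hKc : IsCompact K)
    {φ : Plane → ℝ} (hφ : ContDiff ℝ 1 φ) :
    ∃ c : ℝ, ∫ x in K, (φ x - c) ^ 2 ≤
      4 * Metric.diam K ^ 2 * ∫ x in K, ‖fderiv ℝ φ x‖ ^ 2 := by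
  rcases eq_or_ne (volume K) 0 with h0 | h0
  · exact ⟨0, by simp [Measure.restrict_eq_zero.mpr h0]⟩
  have hKm := hKc.measurableSet
  have htop : volume K ≠ ⊤ := hKc.measure_ne_top
  have hφ' := hφ.continuous_fderiv one_ne_zero
  have hφc := hφ.continuous
  let H : Plane → ENNReal := fun x => ENNReal.ofReal (‖fderiv ℝ φ x‖ ^ 2)
  have hHc : Continuous H := ENNReal.continuous_ofReal.comp (hφ'.norm.pow 2)
  have hH : Measurable H := hHc.measurable
  let D : ENNReal := ENNReal.ofReal (Metric.diam K ^ 2)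
  let F : Plane → Plane → ENNReal := fun y x => ENNReal.ofReal ((φ x - φ y) ^ 2)
  have hF : Measurable (Function.uncurry F) := by
    refine ENNReal.measurable_ofReal.comp (Continuous.measurable ?_)
    fun_prop
  have pt : ∀ y ∈ K, ∀ x ∈ K, F y x ≤ D * ∫⁻ t in Icc (0 : ℝ) 1, H ((1 - t) • x + t • y) := by
    intro y hy x hx
    have hc : Continuous fun t : ℝ => ‖fderiv ℝ φ ((1 - t) • x + t • y)‖ ^ 2 :=
      (hφ'.comp (by fun_prop)).norm.pow 2
    rw [← ofReal_integral_eq_lintegral_ofReal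
      (hc.continuousOn.integrableOn_compact isCompact_Icc) (ae_of_all _ fun t => by positivity),
      ← ENNReal.ofReal_mul (by positivity)]
    refine ENNReal.ofReal_le_ofReal ?_
    rw [← neg_sub, neg_sq]
    refine (sq_sub_le_integral_segment hφ x y).trans ?_
    gcongr
    rw [← dist_eq_norm]
    exact Metric.dist_le_diam_of_mem hKc.isBounded hy hx
  have total : ∫⁻ y in K, ∫⁻ x in K, F y x ≤ D * (4 * (∫⁻ x in K, H x) * volume K) := by
    calc ∫⁻ y in K, ∫⁻ x in K, F y x
        ≤ ∫⁻ y in K, ∫⁻ x in K, D * ∫⁻ t in Icc (0 : ℝ) 1, H ((1 - t) • x + t • y) := by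
          refine setLIntegral_mono' hKm fun y hy => setLIntegral_mono' hKm fun x hx => pt y hy x hx
      _ = D * ∫⁻ y in K, ∫⁻ x in K, ∫⁻ t in Icc (0 : ℝ) 1, H ((1 - t) • x + t • y) := by
          rw [← lintegral_const_mul _ (by fun_prop)]
          refine lintegral_congr fun y => ?_
          rw [lintegral_const_mul _ (by fun_prop)]
      _ = D * ∫⁻ t in Icc (0 : ℝ) 1, ∫⁻ y in K, ∫⁻ x in K, H ((1 - t) • x + t • y) := by
          congr 1
          exact (lintegral_congr fun y => lintegral_lintegral_swap
            (Measurable.aemeasurable (by fun_prop))).trans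
            (lintegral_lintegral_swap (Measurable.aemeasurable (by fun_prop)))
      _ ≤ D * ∫⁻ t in Icc (0 : ℝ) 1, 4 * (∫⁻ x in K, H x) * volume K := by
          gcongr D * ?_
          exact setLIntegral_mono measurable_const fun t ht =>
            lintegral_lintegral_segment_le hK hKm hH ht
      _ = _ := by simp
  obtain ⟨y, -, hy⟩ := exists_le_setLAverage h0 htop
    (hF.lintegral_prod_right' (ν := volume.restrict K)).aemeasurable
  refine ⟨φ y, ?_⟩
  have fin : ∫⁻ x in K, F y x ≤ D * (4 * ∫⁻ x in K, H x) := by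
    refine hy.trans ?_
    rw [setLAverage_eq]
    refine ENNReal.div_le_of_le_mul (total.trans_eq (by ring))
  have i1 : IntegrableOn (fun x => (φ x - φ y) ^ 2) K :=
    Continuous.continuousOn (by fun_prop) |>.integrableOn_compact hKc
  have i2 : IntegrableOn (fun x => ‖fderiv ℝ φ x‖ ^ 2) K :=
    (hφ'.norm.pow 2).continuousOn.integrableOn_compact hKc
  have e1 := ofReal_integral_eq_lintegral_ofReal i1 (ae_of_all _ fun x => sq_nonneg _)
  have e2 := ofReal_integral_eq_lintegral_ofReal i2 (ae_of_all _ fun x => sq_nonneg _)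
  simp only [F, H] at fin
  have h4 : (4 : ENNReal) = ENNReal.ofReal 4 := by simp
  rw [← e1, ← e2, h4, ← ENNReal.ofReal_mul (by norm_num),
    ← ENNReal.ofReal_mul (by positivity),
    ENNReal.ofReal_le_ofReal_iff (by positivity)] at fin
  linarith

/-! ### Triangulations as almost everywhere partitions -/

/-- Two points span at most a line, so that their convex hull is null in the plane. -/
theorem volume_convexHull_of_card_le_two {s : Finset Plane} (hs : s.card ≤ 2) :
    volume (convexHull ℝ (s : Set Plane)) = 0 := by
  refine measure_mono_null (convexHull_subset_affineSpan _)
    (Measure.addHaar_affineSubspace _ _ fun h => ?_)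
  rcases s.eq_empty_or_nonempty with rfl | hne
  · rw [Finset.coe_empty, AffineSubspace.span_empty] at h
    exact AffineSubspace.bot_ne_top ℝ Plane Plane h
  · have h1 : Module.finrank ℝ (vectorSpan ℝ (s : Set Plane)) = 2 := by
      rw [← direction_affineSpan, h, AffineSubspace.direction_top, finrank_top]
      simp
    have hpos := hne.card_pos
    have h2 := finrank_vectorSpan_range_le ℝ (fun p : s => (p : Plane)) (n := s.card - 1)
      (by simp; omega)
    rw [show range (fun p : s => (p : Plane)) = (s : Set Plane) from Subtype.range_coe] at h2
    omega

namespace Triangulation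

variable {Ω : Set Plane} (𝒯 : Triangulation Ω)

theorem isCompact_triangle (t : Finset Plane) : IsCompact (convexHull ℝ (t : Set Plane)) :=
  t.finite_toSet.isCompact_convexHull ℝ

/-- Distinct triangles of a conforming triangulation have at most two common vertices, whose convex
hull is their intersection. -/
theorem volume_inter_triangles {t₁ t₂ : Finset Plane} (h₁ : t₁ ∈ 𝒯.triangles)
    (h₂ : t₂ ∈ 𝒯.triangles) (hne : t₁ ≠ t₂) :
    volume (convexHull ℝ (t₁ : Set Plane) ∩ convexHull ℝ (t₂ : Set Plane)) = 0 := by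
  classical
  rw [𝒯.conforming t₁ h₁ t₂ h₂, ← Finset.coe_inter]
  refine volume_convexHull_of_card_le_two ?_
  have c₁ := 𝒯.card_eq_three t₁ h₁
  have c₂ := 𝒯.card_eq_three t₂ h₂
  by_contra! hlt
  have e₁ := Finset.eq_of_subset_of_card_le (Finset.inter_subset_left (s₁ := t₁) (s₂ := t₂))
    (by omega)
  have e₂ := Finset.eq_of_subset_of_card_le (Finset.inter_subset_right (s₁ := t₁) (s₂ := t₂))
    (by omega)
  exact hne (e₁.symm.trans e₂)

/-- A triangle lies in `Ω` up to its frontier, which is null. -/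
theorem restrict_restrict_triangle {t : Finset Plane} (ht : t ∈ 𝒯.triangles) :
    (volume.restrict Ω).restrict (convexHull ℝ (t : Set Plane)) =
      volume.restrict (convexHull ℝ (t : Set Plane)) := by
  rw [Measure.restrict_restrict (isCompact_triangle t).measurableSet]
  refine Measure.restrict_congr_set (ae_eq_set.mpr ⟨?_, ?_⟩)
  · rw [sdiff_eq_empty.mpr inter_subset_left, measure_empty]
  · refine measure_mono_null (fun x hx => ?_)
      ((convex_convexHull ℝ (t : Set Plane)).addHaar_frontier volume)
    exact ⟨subset_closure hx.1, fun hi => hx.2 ⟨hx.1, 𝒯.interior_subset t ht hi⟩⟩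

theorem integral_eq_sum_triangles {h : Plane → ℝ} (hh : Integrable h (volume.restrict Ω)) :
    ∫ x in Ω, h x =
      ∑ t ∈ 𝒯.triangles, ∫ x in convexHull ℝ (t : Set Plane), h x ∂(volume.restrict Ω) := by
  have hU : ⋃ t : 𝒯.triangles, convexHull ℝ ((t : Finset Plane) : Set Plane) = closure Ω := by
    rw [← 𝒯.iUnion_eq, iUnion_subtype]
  have hr : (volume.restrict Ω).restrict (closure Ω) = volume.restrict Ω := by
    rw [Measure.restrict_restrict isClosed_closure.measurableSet,
      inter_eq_right.mpr subset_closure]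
  have := integral_iUnion_ae (μ := volume.restrict Ω) (f := h)
    (s := fun t : 𝒯.triangles => convexHull ℝ ((t : Finset Plane) : Set Plane))
    (fun t => (isCompact_triangle _).measurableSet.nullMeasurableSet)
    (fun t₁ t₂ hne => Measure.absolutelyContinuous_of_le Measure.restrict_le_self
      (𝒯.volume_inter_triangles t₁.2 t₂.2 (Subtype.coe_injective.ne hne)))
    hh.integrableOn
  rw [hU, hr, tsum_fintype] at this
  rw [this]
  exact Finset.sum_coe_sort 𝒯.triangles
    fun t => ∫ x in convexHull ℝ (t : Set Plane), h x ∂(volume.restrict Ω)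

/-- Indicators of triangles are piecewise polynomial of every degree, hence `f - f_H` has mean
value zero on every triangle. -/
theorem integral_sub_proj_eq_zero {t : Finset Plane} (ht : t ∈ 𝒯.triangles)
    (k : ℕ) (f : L2 Ω) :
    ∫ x in convexHull ℝ (t : Set Plane), (f - 𝒯.proj k f) x ∂(volume.restrict Ω) = 0 := by
  have hm := (isCompact_triangle t).measurableSet
  have hfin : (volume.restrict Ω) (convexHull ℝ (t : Set Plane)) ≠ ⊤ :=
    ((Measure.restrict_apply_le _ _).trans_lt (isCompact_triangle t).measure_lt_top).ne
  have hmem : indicatorConstLp 2 hm hfin (1 : ℝ) ∈ 𝒯.piecewisePoly k := by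
    intro t' ht'
    by_cases htt : t' = t
    · subst htt
      refine ⟨1, by simp, ?_⟩
      filter_upwards [ae_restrict_of_ae (indicatorConstLp_coeFn (p := 2) (hs := hm)
        (hμs := hfin) (c := (1 : ℝ))), ae_restrict_mem hm] with x hx hxt
      rw [hx, indicator_of_mem hxt, map_one]
    · refine ⟨0, by simp, ?_⟩
      have hnull : ∀ᵐ x ∂((volume.restrict Ω).restrict (convexHull ℝ (t' : Set Plane))),
          x ∉ convexHull ℝ (t : Set Plane) := by
        rw [ae_iff]
        simp only [not_not]
        change ((volume.restrict Ω).restrict _) (convexHull ℝ (t : Set Plane)) = 0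
        rw [𝒯.restrict_restrict_triangle ht', Measure.restrict_apply hm]
        exact 𝒯.volume_inter_triangles ht ht' (Ne.symm htt)
      filter_upwards [ae_restrict_of_ae (indicatorConstLp_coeFn (p := 2) (hs := hm)
        (hμs := hfin) (c := (1 : ℝ))), hnull] with x hx hxt
      rw [hx, indicator_of_notMem hxt, map_zero]
  have h0 := (𝒯.piecewisePoly k).sub_starProjection_mem_orthogonal f _ hmem
  rwa [L2.inner_indicatorConstLp_one] at h0

end Triangulation

/-! ### The energy estimate -/

/-- An element of the closure of the range of `G` is controlled by its inner products with that
range; membership in the closure is expressed as orthogonality to everything orthogonal to the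
range. -/
theorem norm_le_of_abs_inner_range_le {E H : Type*} [AddCommGroup E] [Module ℝ E]
    [NormedAddCommGroup H] [InnerProductSpace ℝ H] [CompleteSpace H] (G : E →ₗ[ℝ] H) {σ : H}
    (hσ : ∀ τ : H, (∀ e, ⟪τ, G e⟫_ℝ = 0) → ⟪σ, τ⟫_ℝ = 0) {M : ℝ}
    (hM0 : 0 ≤ M) (hM : ∀ e, |⟪σ, G e⟫_ℝ| ≤ M * ‖G e‖) : ‖σ‖ ≤ M := by
  have hmem : σ ∈ closure (LinearMap.range G : Set H) := by
    rw [← Submodule.topologicalClosure_coe, ← Submodule.orthogonal_orthogonal_eq_closure]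
    refine (Submodule.mem_orthogonal' _ _).mpr fun τ hτ => hσ τ fun e => ?_
    exact (Submodule.mem_orthogonal' _ _).mp hτ _ (LinearMap.mem_range_self G e)
  have hcl : closure (LinearMap.range G : Set H) ⊆ {x | |⟪σ, x⟫_ℝ| ≤ M * ‖x‖} := by
    refine closure_minimal ?_ (isClosed_le (by fun_prop) (by fun_prop))
    rintro _ ⟨e, rfl⟩
    exact hM e
  have h : |⟪σ, σ⟫_ℝ| ≤ M * ‖σ‖ := hcl hmem
  rcases eq_or_ne σ 0 with h0 | h0
  · rwa [h0, norm_zero]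
  · rw [real_inner_self_eq_norm_sq, abs_of_nonneg (sq_nonneg _), sq] at h
    exact le_of_mul_le_mul_right h (norm_pos_iff.mpr h0)

theorem norm_gradToL2_eq {Ω : Set Plane} (φ : testFunctions Ω) :
    ‖gradToL2 Ω φ‖ = √(∫ x in Ω, ‖fderiv ℝ (φ : Plane → ℝ) x‖ ^ 2) := by
  rw [norm_eq_sqrt_real_inner, L2.inner_def]
  congr 1
  refine integral_congr_ae ?_
  filter_upwards [(testFunctions.memLp_gradient φ.2).coeFn_toLp] with x hx
  have : (gradToL2 Ω φ) x = gradient (φ : Plane → ℝ) x := hx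
  rw [real_inner_self_eq_norm_sq, this]
  simp [gradient]

/-- The dual norm of `f - f_H` with respect to the energy norm is at most twice the oscillation:
on every triangle a constant may be subtracted from the test function, and Poincaré's inequality
applies. -/
theorem abs_inner_sub_proj_testToL2_le {Ω : Set Plane}
    (𝒯 : Triangulation Ω) (k : ℕ) (f : L2 Ω) (φ : testFunctions Ω) :
    |⟪f - 𝒯.proj k f, testToL2 Ω φ⟫_ℝ| ≤ 2 * 𝒯.osc k f * ‖gradToL2 Ω φ‖ := by
  set g : L2 Ω := f - 𝒯.proj k f with hg
  set φ' : Plane → ℝ := φ.1 with hφ'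
  have hgm : MemLp g 2 (volume.restrict Ω) := Lp.memLp g
  have hφm : MemLp φ' 2 (volume.restrict Ω) := testFunctions.memLp φ.2
  have hφ1 : ContDiff ℝ 1 φ' := φ.2.1.of_le (by simp)
  have hdi : Integrable (fun x => ‖fderiv ℝ φ' x‖ ^ 2) (volume.restrict Ω) := by
    have := (testFunctions.memLp_gradient φ.2).norm.integrable_sq
    refine this.congr (ae_of_all _ fun x => ?_)
    simp [gradient, hφ']
  let d : Finset Plane → ℝ := fun t => Metric.diam (convexHull ℝ (t : Set Plane))
  let A : Finset Plane → ℝ := fun t =>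
    ∫ x in convexHull ℝ (t : Set Plane), g x ^ 2 ∂(volume.restrict Ω)
  let B : Finset Plane → ℝ := fun t =>
    ∫ x in convexHull ℝ (t : Set Plane), ‖fderiv ℝ φ' x‖ ^ 2 ∂(volume.restrict Ω)
  have hA : ∀ t, 0 ≤ A t := fun t => integral_nonneg fun x => sq_nonneg _
  have hB : ∀ t, 0 ≤ B t := fun t => integral_nonneg fun x => sq_nonneg _
  have hosc : 𝒯.osc k f = √(∑ t ∈ 𝒯.triangles, d t ^ 2 * A t) := by
    unfold Triangulation.osc
    congr 1
    refine Finset.sum_congr rfl fun t _ => ?_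
    congr 1
    refine integral_congr_ae (ae_restrict_of_ae ?_)
    filter_upwards [Lp.coeFn_sub f (𝒯.proj k f)] with x hx
    rw [hg, hx, Pi.sub_apply]
  have hinner : ⟪g, testToL2 Ω φ⟫_ℝ = ∫ x in Ω, g x * φ' x := by
    rw [L2.inner_def]
    refine integral_congr_ae ?_
    filter_upwards [hφm.coeFn_toLp] with x hx
    have : (testToL2 Ω φ) x = φ' x := hx
    simp [this, mul_comm]
  have local_le : ∀ t ∈ 𝒯.triangles,
      |∫ x in convexHull ℝ (t : Set Plane), g x * φ' x ∂(volume.restrict Ω)|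
        ≤ 2 * (√(d t ^ 2 * A t) * √(B t)) := by
    intro t ht
    have hKc := Triangulation.isCompact_triangle t
    obtain ⟨c, hc⟩ := exists_integral_sub_sq_le (convex_convexHull ℝ (t : Set Plane)) hKc hφ1
    rw [← 𝒯.restrict_restrict_triangle ht] at hc
    have hfin : IsFiniteMeasure ((volume.restrict Ω).restrict (convexHull ℝ (t : Set Plane))) := by
      rw [𝒯.restrict_restrict_triangle ht]
      exact isFiniteMeasure_restrict.mpr hKc.measure_ne_top
    have hgt := hgm.restrict (convexHull ℝ (t : Set Plane))
    have hφt := hφm.restrict (convexHull ℝ (t : Set Plane))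
    have hsub := hφt.sub (memLp_const c)
    have e : ∫ x in convexHull ℝ (t : Set Plane), g x * φ' x ∂(volume.restrict Ω)
        = ∫ x in convexHull ℝ (t : Set Plane), g x * (φ' x - c) ∂(volume.restrict Ω) := by
      simp only [mul_sub]
      have hi : Integrable (fun x => g x * φ' x)
          ((volume.restrict Ω).restrict (convexHull ℝ (t : Set Plane))) := hgt.integrable_mul hφt
      rw [integral_sub hi ((hgt.integrable one_le_two).mul_const c), integral_mul_const,
        𝒯.integral_sub_proj_eq_zero ht k f]
      simp
    rw [e]
    refine (abs_integral_mul_le_sqrt hgt hsub).trans ?_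
    calc √(A t) * √(∫ x in convexHull ℝ (t : Set Plane), (φ' x - c) ^ 2 ∂(volume.restrict Ω))
        ≤ √(A t) * √((2 * d t) ^ 2 * B t) := by
          gcongr
          refine hc.trans_eq ?_
          ring
      _ = 2 * (√(d t ^ 2 * A t) * √(B t)) := by
          have hd : 0 ≤ d t := Metric.diam_nonneg
          rw [Real.sqrt_mul (sq_nonneg _), Real.sqrt_mul (sq_nonneg _), Real.sqrt_sq hd,
            Real.sqrt_sq (by positivity)]
          ring
  have hgφ : Integrable (fun x => g x * φ' x) (volume.restrict Ω) := hgm.integrable_mul hφm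
  rw [hinner, 𝒯.integral_eq_sum_triangles hgφ]
  calc |∑ t ∈ 𝒯.triangles, ∫ x in convexHull ℝ (t : Set Plane), g x * φ' x ∂(volume.restrict Ω)|
      ≤ ∑ t ∈ 𝒯.triangles, 2 * (√(d t ^ 2 * A t) * √(B t)) :=
        (Finset.abs_sum_le_sum_abs _ _).trans (Finset.sum_le_sum local_le)
    _ ≤ 2 * (√(∑ t ∈ 𝒯.triangles, d t ^ 2 * A t) * √(∑ t ∈ 𝒯.triangles, B t)) := by
        rw [← Finset.mul_sum]
        gcongr
        exact Real.sum_sqrt_mul_sqrt_le _ (fun t => mul_nonneg (sq_nonneg _) (hA t)) hB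
    _ = 2 * 𝒯.osc k f * ‖gradToL2 Ω φ‖ := by
        rw [hosc, norm_gradToL2_eq, 𝒯.integral_eq_sum_triangles hdi, mul_assoc]

end MixedPoisson

theorem mainTheorem6 (κ : ℝ) :
    ∃ C₀ : ℝ, 0 < C₀ ∧
      ∀ (Ω : Set Plane) (hΩ : MixedPoisson.IsPolygonalDomain Ω)
        (𝒯 : MixedPoisson.Triangulation Ω), 𝒯.ShapeRegular κ →
      ∀ (k : ℕ) (f : MixedPoisson.L2 Ω),
        ‖(MixedPoisson.solutionOp hΩ f).1 - (MixedPoisson.solutionOp hΩ (𝒯.proj k f)).1‖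
          ≤ Real.sqrt C₀ * 𝒯.osc k f := by
  refine ⟨2 ^ 2, by norm_num, fun Ω hΩ 𝒯 _ k f => ?_⟩
  rw [Real.sqrt_sq zero_le_two]
  obtain ⟨h1, d, hd, hdf⟩ := MixedPoisson.solutionOp_spec hΩ f
  obtain ⟨h1', d', hd', hdf'⟩ := MixedPoisson.solutionOp_spec hΩ (𝒯.proj k f)
  -- The weak divergences of the two fluxes are the data themselves.
  obtain rfl : d = f := ext_inner_right ℝ hdf
  obtain rfl : d' = 𝒯.proj k d := ext_inner_right ℝ hdf'
  rw [MixedPoisson.hasWeakDiv_iff] at hd hd'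
  refine MixedPoisson.norm_le_of_abs_inner_range_le (MixedPoisson.gradToL2 Ω)
    (σ := (MixedPoisson.solutionOp hΩ d).1 - (MixedPoisson.solutionOp hΩ (𝒯.proj k d)).1)
    (fun τ hτ => ?_) (mul_nonneg zero_le_two (Real.sqrt_nonneg _)) (fun φ => ?_)
  · -- A field orthogonal to all gradients has weak divergence zero.
    have hτ' : MixedPoisson.HasWeakDiv Ω τ 0 := by
      rw [MixedPoisson.hasWeakDiv_iff]
      simpa using hτ
    have a := h1 τ 0 hτ'
    have b := h1' τ 0 hτ'
    rw [inner_zero_left, sub_zero] at a b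
    rw [inner_sub_left, a, b, sub_zero]
  · have e : ⟪(MixedPoisson.solutionOp hΩ d).1 - (MixedPoisson.solutionOp hΩ (𝒯.proj k d)).1,
        MixedPoisson.gradToL2 Ω φ⟫_ℝ = -⟪d - 𝒯.proj k d, MixedPoisson.testToL2 Ω φ⟫_ℝ := by
      rw [inner_sub_left, inner_sub_left, hd φ, hd' φ]
      ring
    rw [e, abs_neg]
    exact MixedPoisson.abs_inner_sub_proj_testToL2_le 𝒯 k d φ
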